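/- **Definitions.** An *alternative division ring* is a unital, not necessarily associative ring $F$ with $0\neq 1$ satisfying $(xx)y=x(xy)$ and $(yx)x=y(xx)$ for all $x,y\in F$, in which every $x\neq 0$ has a two-sided multiplicative inverse $x^{-1}$. (Fields and skew fields are exactly the commutative associative, respectively the associative, ones.) Let $P=F\cup\{\infty\}$ and let $G$ be the group of permutations of $P$ generated by the maps $\tau_a\colon x\mapsto a+x$ for all $a\in F$ and the involution $i\colon x\mapsto -x^{-1}$, with the conventions $0^{-1}=\infty$, $\infty^{-1}=0$, $-\infty=\infty$ and $a+\infty=\infty$. The pair $(G,P)$ is the *projective line* over $F$. It is a *compact projective line* if $F$ is infinite, $P$ carries a compact Hausdorff topology, and every element of $G$ is a homeomorphism of $P$. **Theorem.** Let $F$ be a field, a skew field or an alternative division ring, and suppose that its projective line $(G,P)$ is a compact projective line. Endow $F\subseteq P$ with the subspace topology. Then $F$ is a (Hausdorff) locally compact, non-discrete, $\sigma$-compact topological field, skew field or alternative division ring, respectively: addition, negation and multiplication are continuous on $F$, and inversion $x\mapsto x^{-1}$ is continuous on $F\setminus\{0\}$. -/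

import Mathlib

universe u

/-- An alternative division ring: a unital, not necessarily associative ring with `0 ≠ 1` that
satisfies the two alternative laws and in which every nonzero element has a two-sided
multiplicative inverse.  As in Mathlib's `DivisionRing`, the inverse is totalised by `0⁻¹ = 0`. -/
class AlternativeDivisionRing (F : Type u) extends NonAssocRing F, Inv F, Nontrivial F where
  left_alternative : ∀ x y : F, (x * x) * y = x * (x * y)
  right_alternative : ∀ x y : F, (y * x) * x = y * (x * x)
  mul_inv_cancel : ∀ x : F, x ≠ 0 → x * x⁻¹ = 1
  inv_mul_cancel : ∀ x : F, x ≠ 0 → x⁻¹ * x = 1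
  inv_zero : (0 : F)⁻¹ = 0

/-- Fields and skew fields are the associative alternative division rings. -/
instance DivisionRing.toAlternativeDivisionRing (K : Type u) [DivisionRing K] :
    AlternativeDivisionRing K where
  left_alternative x y := mul_assoc x x y
  right_alternative x y := mul_assoc y x x
  mul_inv_cancel _ hx := mul_inv_cancel₀ hx
  inv_mul_cancel _ hx := inv_mul_cancel₀ hx
  inv_zero := _root_.inv_zero

namespace AlternativeDivisionRing

variable {F : Type u} [AlternativeDivisionRing F]

theorem associator_left (x y : F) : associator x x y = 0 := by
  rw [associator_apply, left_alternative, sub_self]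

theorem associator_right (x y : F) : associator y x x = 0 := by
  rw [associator_apply, right_alternative, sub_self]

theorem associator_swap_left (x y z : F) : associator x y z = -associator y x z := by
  have h := associator_left (x + y) z
  have h1 := associator_left x z
  have h2 := associator_left y z
  simp only [associator_apply, add_mul, mul_add] at *
  linear_combination (norm := module) (1 : ℤ) • h - (1 : ℤ) • h1 - (1 : ℤ) • h2

theorem associator_swap_right (x y z : F) : associator x y z = -associator x z y := by
  have h := associator_right (y + z) x
  have h1 := associator_right y x
  have h2 := associator_right z x
  simp only [associator_apply, add_mul, mul_add] at *
  linear_combination (norm := module) (1 : ℤ) • h - (1 : ℤ) • h1 - (1 : ℤ) • h2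

theorem associator_one (x y : F) : associator x 1 y = 0 ∧ associator 1 x y = 0 ∧
    associator x y 1 = 0 := by
  simp [associator_apply]

/-- If `a b = 1 = b a`, then `(a, b, z)` is annihilated by `a` from both sides. -/
theorem associator_annihilated {a b : F} (hab : a * b = 1) (hba : b * a = 1) (z : F) :
    a * associator a b z = 0 ∧ associator a b z * a = 0 := by
  have flip (x y : F) : associator x y x = 0 := by
    rw [associator_swap_right, associator_left, neg_zero]
  have e1 := associator_cocycle a b a z
  rw [hab, hba, (associator_one a z).1, (associator_one a z).2.1, flip a b,
    associator_swap_left b a z] at e1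
  -- `(a, b, a z) = -a (a, b, z)`
  have e2 := associator_cocycle b a z a
  rw [hba, (associator_one z a).2.1, flip a z, associator_swap_left b a z,
    associator_swap_left b a (z * a), associator_swap_right b (a * z) a,
    associator_swap_left b a (a * z)] at e2
  have e3 := associator_cocycle a a b z
  rw [hab, (associator_one a z).1, associator_left, associator_left] at e3
  have e4 := associator_cocycle z a a b
  rw [hab, (associator_one z a).2.2, associator_left, associator_right,
    associator_swap_right (z * a) a b, associator_swap_left (z * a) b a,
    associator_swap_right b (z * a) a, associator_swap_left b a (z * a),
    associator_swap_left z (a * a) b, associator_swap_right (a * a) z b] at e4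
  have e5 := associator_cocycle z a b a
  rw [hab, hba, (associator_one z a).1, (associator_one z a).2.2, flip a b,
    associator_swap_right z a b, associator_swap_left z b a,
    associator_swap_right b z a, associator_swap_left b a z,
    associator_swap_left (z * a) b a, associator_swap_right b (z * a) a,
    associator_swap_left b a (z * a)] at e5
  simp only [mul_neg, neg_mul, neg_neg, mul_zero, zero_mul, sub_zero, zero_sub, add_zero,
    zero_add] at e1 e2 e3 e4 e5
  exact ⟨by linear_combination (norm := module) (1 : ℤ) • e1 + (1 : ℤ) • e2 + (2 : ℤ) • e3 + (2 : ℤ) • e4 + (1 : ℤ) • e5,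
    by linear_combination (norm := module) (-1 : ℤ) • e1 - (1 : ℤ) • e2 - (1 : ℤ) • e3 - (1 : ℤ) • e4⟩

theorem left_cancel_of_inverse {a b : F} (hab : a * b = 1) (hba : b * a = 1) (z : F) :
    b * (a * z) = z := by
  have hz (x : F) : associator b a x = x - b * (a * x) := by
    rw [associator_apply, hba, one_mul]
  have h1 := associator_annihilated hab hba z
  have h2 := associator_annihilated hba hab z
  rw [associator_swap_left a b z, neg_mul, mul_neg, neg_eq_zero, neg_eq_zero] at h1
  have h3 := hz (associator b a z)
  rw [h1.1, mul_zero, sub_zero, associator_swap_right, associator_apply, h2.1, h1.2, zero_mul,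
    mul_zero, sub_zero, neg_zero, hz] at h3
  exact (sub_eq_zero.1 h3.symm).symm

/-- Two-sided inverses are unique. -/
theorem eq_inv_of_mul_eq_one {x y : F} (h : x * y = 1) : y = x⁻¹ := by
  have hx : x ≠ 0 := by
    rintro rfl
    simp at h
  have := left_cancel_of_inverse (mul_inv_cancel x hx) (inv_mul_cancel x hx) y
  rw [h, mul_one] at this
  exact this.symm

theorem inv_ne_zero' {x : F} (hx : x ≠ 0) : x⁻¹ ≠ 0 := by
  intro h
  have := mul_inv_cancel x hx
  simp [h] at this

theorem neg_inv_neg_inv {x : F} (hx : x ≠ 0) : -(-x⁻¹)⁻¹ = x := by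
  rw [neg_eq_iff_eq_neg]
  refine (eq_inv_of_mul_eq_one ?_).symm
  rw [neg_mul_neg, inv_mul_cancel x hx]

end AlternativeDivisionRing

/-- The point set `P = F ∪ {∞}` of the projective line over `F`. -/
inductive ProjectiveLine (F : Type u) : Type u
  | point (x : F) : ProjectiveLine F
  | infty : ProjectiveLine F

namespace ProjectiveLine

variable {F : Type u} [AlternativeDivisionRing F]

/-- The map `x ↦ a + x` on `P`, with `a + ∞ = ∞`. -/
def translate (a : F) : ProjectiveLine F → ProjectiveLine F
  | point x => point (a + x)
  | infty => infty

/-- The permutation `τ_a : x ↦ a + x` of `P`. -/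
def translation (a : F) : Equiv.Perm (ProjectiveLine F) where
  toFun := translate a
  invFun := translate (-a)
  left_inv p := by cases p <;> simp [translate]
  right_inv p := by cases p <;> simp [translate]

open Classical in
/-- The map `x ↦ -x⁻¹` on `P`, with `0⁻¹ = ∞`, `∞⁻¹ = 0` and `-∞ = ∞`. -/
noncomputable def negInv : ProjectiveLine F → ProjectiveLine F
  | point x => if x = 0 then infty else point (-x⁻¹)
  | infty => point 0

theorem negInv_negInv (p : ProjectiveLine F) : negInv (negInv p) = p := by
  cases p with
  | infty => simp [negInv]
  | point x =>
    by_cases hx : x = 0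
    · simp [negInv, hx]
    · simp [negInv, hx, AlternativeDivisionRing.inv_ne_zero' hx,
        AlternativeDivisionRing.neg_inv_neg_inv hx]

/-- The involution `i : x ↦ -x⁻¹` of `P`, as a permutation. -/
noncomputable def inversion : Equiv.Perm (ProjectiveLine F) where
  toFun := negInv
  invFun := negInv
  left_inv := negInv_negInv
  right_inv := negInv_negInv

variable (F) in
/-- The permutation group `G` on `P` generated by all `τ_a` and by `i`. -/
noncomputable def projectiveGroup : Subgroup (Equiv.Perm (ProjectiveLine F)) :=
  Subgroup.closure (Set.range (translation (F := F)) ∪ {inversion})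

end ProjectiveLine

/-- `(G, P)` is a compact projective line with respect to the given topology on `P = F ∪ {∞}`:
`F` is infinite, `P` is compact and Hausdorff, and `G` acts on `P` by homeomorphisms. -/
structure IsCompactProjectiveLine (F : Type u) [AlternativeDivisionRing F]
    [TopologicalSpace (ProjectiveLine F)] : Prop where
  infinite : Infinite F
  compactSpace : CompactSpace (ProjectiveLine F)
  t2Space : T2Space (ProjectiveLine F)
  isHomeomorph : ∀ g ∈ ProjectiveLine.projectiveGroup F, IsHomeomorph g

/-- A topological alternative division ring: addition, negation and multiplication are
continuous, and inversion is continuous at every nonzero element. -/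
class IsTopologicalAlternativeDivisionRing (F : Type u) [AlternativeDivisionRing F]
    [TopologicalSpace F] : Prop extends IsTopologicalRing F, ContinuousInv₀ F

/-- For fields and skew fields this is Mathlib's notion of a topological (skew) field. -/
theorem isTopologicalAlternativeDivisionRing_iff (K : Type u) [DivisionRing K]
    [TopologicalSpace K] :
    IsTopologicalAlternativeDivisionRing K ↔ IsTopologicalDivisionRing K :=
  ⟨fun h => { toIsTopologicalRing := h.toIsTopologicalRing, toContinuousInv₀ := h.toContinuousInv₀ },
   fun h => { toIsTopologicalRing := h.toIsTopologicalRing, toContinuousInv₀ := h.toContinuousInv₀ }⟩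

/-!
The additive group comes first. The addition extends to a map `P × P → P`, with value `∞` as soon
as one argument is `∞`, and this map is separately continuous. A separately continuous real
function on a product of compact spaces oscillates arbitrarily little, uniformly in the second
variable, on suitable open sets of the first (`exists_isOpen_forall_abs_sub_le`; otherwise a Cantor
scheme produces an uncountable uniformly separated subset of `C(Z)` with `Z` compact metrizable).
Translating such an open set to the origin shows that `F` acts jointly continuously on `P`, and so
`F` is a topological group.

Hua's identity `x y x = x - (x⁻¹ + (y⁻¹ - x)⁻¹)⁻¹` then makes the Jordan operations continuous,
first off a finite set and, by additivity of polarisations, everywhere. In particular `F` is the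
union of the compact sets `d⁻¹ K d⁻¹`, where `K` is a compact neighbourhood of zero and `d` runs
through a sequence accumulating at zero; so `F` is `σ`-compact, and the closed graph theorem
applies to its additive endomorphisms.

The Jordan operations do not see the difference between `F` and its opposite, and the main point is
to recover the multiplication. Let `L` be the left multiplication by `e` and let `Σ` be the set of
limits of `e x` as `x` tends to zero; `L` is continuous as soon as `Σ = 0`. If `F` is commutative,
`(e x)² = e x² e` gives `Σ = 0`. In general, the commutator of `L` with the Jordan multiplication
by `b` is `B x = e (b x) - (b e) x`, and it is a polynomial in Jordan operators, hence continuous.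
It follows that `Σ` is stable under Jordan multiplications. Moreover `B L` is an operator of the
same shape as `B`, so that `B` kills `Σ`. If `Σ ≠ 0`, this forces `e` to commute with everything
or, in characteristic two, forces `e²` to do so (`commute_of_jordan_stable`). The elements `e` with
`L` continuous form an additive subgroup, and in a noncommutative `F` a subgroup that contains all
elements without this commutation property is everything (`mem_of_contains_noncentral`). So the
multiplication is separately continuous, and Baire's theorem makes it jointly continuous.
-/

/-! ### Identities in alternative division rings -/

namespace AlternativeDivisionRing

variable {F : Type u} [AlternativeDivisionRing F]

theorem flexible (x y : F) : (x * y) * x = x * (y * x) := by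
  have h : associator x y x = 0 := by rw [associator_swap_right, associator_left, neg_zero]
  rwa [associator_apply, sub_eq_zero] at h

theorem associator_cyclic (x y z : F) : associator x y z = associator y z x := by
  rw [associator_swap_left, associator_swap_right, neg_neg]

theorem mul_associator_self (e w y : F) :
    e * associator e w y = associator e (w * e) y := by
  have h1 := associator_cocycle e e y w
  have h2 := associator_cocycle w e e y
  rw [associator_left e (y * w), associator_left e y, associator_swap_right e y w,
    associator_swap_right (e * e) y w] at h1
  rw [associator_left, associator_right, associator_swap_left (w * e) e y,
    associator_swap_left w (e * e) y, associator_swap_left w e (e * y),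
    associator_swap_right e w (e * y)] at h2
  simp only [mul_neg, mul_zero, zero_mul, sub_zero, add_zero] at h1 h2
  linear_combination (norm := module) -(1 : ℤ) • h1 - (1 : ℤ) • h2

theorem associator_mul_self (e w y : F) :
    associator e w y * e = associator e (e * w) y := by
  have h1 := associator_cocycle e e w y
  have h3 := associator_cocycle y w e e
  rw [associator_left e (w * y), associator_left e w] at h1
  rw [associator_right, associator_right, associator_swap_right y (w * e) e,
    associator_cyclic y e, associator_swap_right y w (e * e), associator_cyclic y (e * e),
    associator_swap_right y w e, associator_cyclic y e] at h3
  simp only [mul_zero, zero_mul, sub_zero, add_zero, neg_mul] at h1 h3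
  have := mul_associator_self e w y
  linear_combination (norm := module) -(1 : ℤ) • h1 - (1 : ℤ) • h3 + (1 : ℤ) • this

/-- The left Moufang identity. -/
theorem moufang_left (e b x : F) : e * (b * (e * x)) = (e * (b * e)) * x := by
  have h1 := mul_associator_self e b x
  rw [associator_swap_left e b x, mul_neg] at h1
  simp only [associator_apply, mul_sub] at h1
  linear_combination (norm := module) (1 : ℤ) • h1

theorem inv_mul_cancel_left' {a : F} (ha : a ≠ 0) (z : F) : a⁻¹ * (a * z) = z :=
  left_cancel_of_inverse (mul_inv_cancel a ha) (inv_mul_cancel a ha) z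

theorem mul_inv_cancel_left' {a : F} (ha : a ≠ 0) (z : F) : a * (a⁻¹ * z) = z :=
  left_cancel_of_inverse (inv_mul_cancel a ha) (mul_inv_cancel a ha) z

theorem mul_inv_cancel_right' {a : F} (ha : a ≠ 0) (z : F) : (z * a) * a⁻¹ = z := by
  have h2 : associator z a a⁻¹ = 0 := by
    rw [associator_cyclic, associator_apply, mul_inv_cancel a ha, one_mul,
      mul_inv_cancel_left' ha, sub_self]
  rw [associator_apply, mul_inv_cancel a ha, mul_one, sub_eq_zero] at h2
  exact h2

theorem eq_zero_of_mul_eq_zero {a b : F} (h : a * b = 0) : a = 0 ∨ b = 0 := by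
  by_cases ha : a = 0
  · exact Or.inl ha
  · right; rw [← inv_mul_cancel_left' ha b, h, mul_zero]

theorem inv_inv' (x : F) : x⁻¹⁻¹ = x := by
  by_cases hx : x = 0
  · rw [hx, inv_zero, inv_zero]
  · exact (eq_inv_of_mul_eq_one (inv_mul_cancel x hx)).symm

theorem inv_add_inv_mul {x y : F} (hx : x ≠ 0) (hy : y ≠ 0) (hxy : x ≠ y⁻¹) :
    (x⁻¹ + (y⁻¹ - x)⁻¹) * (x - x * (y * x)) = 1 := by
  have h1 : (y⁻¹ - x) * (y * x) = x - x * (y * x) := by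
    rw [sub_mul, inv_mul_cancel_left' hy]
  have h2 := inv_mul_cancel_left' (sub_ne_zero.2 hxy.symm) (y * x)
  rw [h1] at h2
  rw [add_mul, h2, mul_sub, inv_mul_cancel x hx, inv_mul_cancel_left' hx, sub_add_cancel]

/-- Hua's identity. -/
theorem hua {x y : F} (hx : x ≠ 0) (hy : y ≠ 0) (hxy : x ≠ y⁻¹) :
    x * (y * x) = x - (x⁻¹ + (y⁻¹ - x)⁻¹)⁻¹ := by
  rw [← eq_inv_of_mul_eq_one (inv_add_inv_mul hx hy hxy), sub_sub_cancel]

/-- The map `x ↦ d⁻¹ x d⁻¹` inverts `x ↦ d x d`. -/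
theorem inv_quad_quad {d : F} (hd : d ≠ 0) (x : F) :
    d⁻¹ * ((d * (x * d)) * d⁻¹) = x := by
  rw [← flexible d x, mul_inv_cancel_right' hd, inv_mul_cancel_left' hd]

/-- The operator `x ↦ e (b x) - (b e) x` is the commutator of the left multiplication by `e`
with the Jordan multiplication `x ↦ b x + x b`. -/
theorem mul_mul_sub_eq_commutator (e b x : F) :
    e * (b * x) - (b * e) * x = e * (b * x + x * b) - (b * (e * x) + (e * x) * b) := by
  have h1 := associator_swap_left e b x
  have h2 := associator_swap_right e b x
  simp only [associator_apply] at h1 h2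
  simp only [mul_add]
  linear_combination (norm := module) (1 : ℤ) • h2 - (1 : ℤ) • h1

/-- The operator `x ↦ e (b x) - (b e) x` is a sum of products of Jordan multiplication operators. -/
theorem mul_mul_sub_eq_jordan (e b x : F) :
    e * (b * x) - (b * e) * x = ((e * b) * x + x * (e * b)) + (b * (x * e) + e * (x * b))
      - (b * (e * x + x * e) + (e * x + x * e) * b) := by
  have h1 := associator_swap_left e b x
  have h2 := associator_cyclic x e b
  have h3 := associator_swap_right e b x
  simp only [associator_apply] at h1 h2 h3
  simp only [mul_add, add_mul]
  linear_combination (norm := module) (1 : ℤ) • h2 - (1 : ℤ) • h1 + (1 : ℤ) • h3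

/-- The operator `x ↦ e (b x) - (b e) x`, precomposed with the left multiplication by `e`, is an
operator of the same shape, with `b e` in place of `b`. -/
theorem mul_mul_sub_mul (e b x : F) :
    e * (b * (e * x)) - (b * e) * (e * x) = e * ((b * e) * x) - ((b * e) * e) * x := by
  have h := associator_swap_left e (b * e) x
  simp only [associator_apply] at h
  rw [moufang_left]
  linear_combination (norm := module) (1 : ℤ) • h

/-- If `e` commutes with `y` and with every `w y + y w`, then `e`, `[e, w]`, `y` associate. -/
theorem mul_commutator_mul {e y : F} (hy : e * y = y * e)
    (h : ∀ w, e * (w * y + y * w) = (w * y + y * w) * e) (w : F) :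
    (e * (e * w - w * e)) * y = e * ((e * w - w * e) * y) := by
  have h1 : (e * w) * y + y * (e * w) = e * (w * y + y * w) - associator e w y := by
    have a1 := associator_swap_left y e w
    have a2 := associator_swap_right e w y
    simp only [associator_apply] at a1 a2 ⊢
    simp only [mul_add]
    have a3 : (e * y) * w = (y * e) * w := by rw [hy]
    linear_combination (norm := module) (2 : ℤ) • a2 - (1 : ℤ) • a1 - (1 : ℤ) • a3
  have h2 := h (e * w)
  rw [h1, mul_sub, sub_mul, mul_associator_self, associator_mul_self, flexible e,
    ← h w, sub_right_inj] at h2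
  have h3 : associator e (e * w - w * e) y = 0 := by
    simp only [associator_apply] at h2 ⊢
    simp only [mul_sub, sub_mul]
    linear_combination (norm := module) -(1 : ℤ) • h2
  rwa [associator_apply, sub_eq_zero] at h3

/-- If a set with a nonzero element is stable under Jordan multiplications and killed by all the
operators `x ↦ e (b x) - (b e) x`, then `e` (in characteristic two, `e ^ 2`) commutes with
everything. -/
theorem commute_of_jordan_stable {e : F} {S : Set F}
    (hS : ∀ y ∈ S, ∀ b, b * y + y * b ∈ S) (hB : ∀ y ∈ S, ∀ b, e * (b * y) = (b * e) * y)
    {y : F} (hy : y ∈ S) (hy0 : y ≠ 0) :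
    ((1 : F) + 1 ≠ 0 → ∀ b, e * b = b * e) ∧
      ((1 : F) + 1 = 0 → ∀ b, (e * e) * b = b * (e * e)) := by
  refine ⟨fun h2 b => ?_, fun h2 w => ?_⟩
  · -- The set contains `y⁻¹ y + y y⁻¹ = 2`, and the operators send `2` to `2 [e, b]`.
    have h := hS y hy y⁻¹
    rw [inv_mul_cancel y hy0, mul_inv_cancel y hy0] at h
    have h' := hB _ h b
    have h'' : (e * b - b * e) * (1 + 1) = 0 := by
      simp only [mul_add, mul_one] at h' ⊢
      linear_combination (norm := module) (1 : ℤ) • h'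
    exact sub_eq_zero.1 ((eq_zero_of_mul_eq_zero h'').resolve_right h2)
  · -- Here `[e, [e, w]] y = 0`, and `[e, [e, w]] = [e ^ 2, w]` in characteristic two.
    have hcomm (y : F) (hy : y ∈ S) : e * y = y * e := by
      by_cases hy0 : y = 0
      · rw [hy0, mul_zero, zero_mul]
      · have h := hB y hy y⁻¹
        rw [inv_mul_cancel y hy0, mul_one] at h
        calc e * y = (y * (y⁻¹ * e)) * y := by rw [mul_inv_cancel_left' hy0]
          _ = y * ((y⁻¹ * e) * y) := flexible _ _
          _ = y * e := by rw [← h]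
    have h1 := mul_commutator_mul (hcomm y hy) (fun w => hcomm _ (hS y hy w)) w
    rw [hB y hy] at h1
    have h3 : (e * (e * w - w * e) - (e * w - w * e) * e) * y = 0 := by
      rw [sub_mul, h1, sub_self]
    have h4 := (eq_zero_of_mul_eq_zero h3).resolve_right hy0
    have h5 : (e * (w * e)) * (1 + 1) = 0 := by rw [h2, mul_zero]
    have h7 : ((w * e) * e) * (1 + 1) = 0 := by rw [h2, mul_zero]
    have h6 := flexible e w
    rw [left_alternative, ← right_alternative]
    simp only [mul_sub, sub_mul, mul_add, mul_one] at h4 h5 h7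
    linear_combination (norm := module) (1 : ℤ) • h4 + (1 : ℤ) • h5 + (1 : ℤ) • h6 - (1 : ℤ) • h7

theorem commute_of_squares_commute (h2 : (1 : F) + 1 = 0)
    (h : ∀ e b : F, (e * e) * b = b * (e * e)) (e b : F) : e * b = b * e := by
  have two (x : F) : x + x = 0 := by
    have : x * (1 + 1) = 0 := by rw [h2, mul_zero]
    rwa [mul_add, mul_one] at this
  -- In characteristic two a commutator is the polarisation of the square, hence central.
  have hc (e b x : F) : (e * b - b * e) * x = x * (e * b - b * e) := by
    have h1 := h (e + b) x
    simp only [mul_add, add_mul, mul_sub, sub_mul] at h1 ⊢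
    linear_combination (norm := module) (1 : ℤ) • h1 - (1 : ℤ) • h e x - (1 : ℤ) • h b x
      - (1 : ℤ) • two ((b * e) * x) + (1 : ℤ) • two (x * (b * e))
  set c := e * b - b * e with hcdef
  -- `e c = [e, e b]` is a commutator as well; comparing it with `c` gives `c ^ 2 = 0`.
  have h1 : b * (e * c) = (e * c) * b := by
    have h3 := hc e (e * b) b
    have h4 : e * (e * b) - (e * b) * e = e * c := by rw [hcdef, mul_sub, flexible]
    rw [h4] at h3
    exact h3.symm
  have h0 : associator e c b = 0 := by
    rw [hcdef, associator_apply]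
    have a1 := associator_mul_self e b b
    have a2 := mul_associator_self e b b
    rw [associator_right] at a1 a2
    simp only [associator_apply, mul_zero, zero_mul] at a1 a2
    simp only [mul_sub, sub_mul]
    linear_combination (norm := module) -(1 : ℤ) • a1 + (1 : ℤ) • a2
  have h3 : associator b e c = 0 := by rw [associator_cyclic, h0]
  rw [associator_apply, sub_eq_zero] at h0 h3
  have h5 : associator e b c = 0 := by
    rw [associator_swap_left, associator_apply, h3, sub_self, neg_zero]
  rw [associator_apply, sub_eq_zero] at h5
  have h6 : c * c = 0 := by
    have : c * c = (e * b) * c - (b * e) * c := by rw [← sub_mul]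
    rw [this, h5, h3, h1, h0, hc e b b, sub_self]
  exact sub_eq_zero.1 ((eq_zero_of_mul_eq_zero h6).elim id id)

/-- In a noncommutative alternative division ring, an additive subgroup that contains all elements
that are not central (in characteristic two, whose square is not central) is everything. -/
theorem mem_of_contains_noncentral {R : AddSubgroup F} (hnc : ∃ a b : F, a * b ≠ b * a)
    (h1 : ∀ e ∉ R, (1 : F) + 1 ≠ 0 → ∀ b, e * b = b * e)
    (h2 : ∀ e ∉ R, (1 : F) + 1 = 0 → ∀ b, (e * e) * b = b * (e * e)) (e : F) : e ∈ R := by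
  by_contra he
  have hadd (r : F) (hr : r ∈ R) : e + r ∉ R := fun h => he ((R.add_mem_cancel_right hr).1 h)
  by_cases h20 : (1 : F) + 1 = 0
  · -- If `f ∈ R` and `e ∉ R`, then `e ^ 2` and `(e + f) ^ 2` commute with `f`, hence so does
    -- `e f + f e`, which says that `f ^ 2` commutes with `e`.
    have key (f : F) (hfR : f ∈ R) (e : F) (he : e ∉ R) : (f * f) * e = e * (f * f) := by
      have h3 := h2 (e + f) (fun h => he ((R.add_mem_cancel_right hfR).1 h)) h20 f
      have h4 := h2 e he h20 f
      have h5 := flexible f e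
      have h6 := left_alternative f e
      have h7 := right_alternative f e
      have h8 := left_alternative f f
      simp only [mul_add, add_mul] at h3
      linear_combination (norm := module) -(1 : ℤ) • h3 + (1 : ℤ) • h4 + (1 : ℤ) • h5
        + (1 : ℤ) • h6 + (1 : ℤ) • h7 + (1 : ℤ) • h8
    obtain ⟨a, b, hab⟩ := hnc
    refine hab (commute_of_squares_commute h20 (fun f x => ?_) a b)
    by_cases hf : f ∈ R
    · by_cases hx : x ∈ R
      · have h3 := key f hf _ (hadd x hx)
        have h4 := key f hf _ he
        rw [mul_add, add_mul, h4] at h3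
        exact add_left_cancel h3
      · exact key f hf x hx
    · exact h2 f hf h20 x
  · obtain ⟨a, b, hab⟩ := hnc
    apply hab
    by_cases ha : a ∈ R
    · have h3 := h1 _ (hadd a ha) h20 b
      rw [mul_add, add_mul, h1 e he h20 b] at h3
      exact add_left_cancel h3
    · exact h1 a ha h20 b

end AlternativeDivisionRing

/-! ### Separately continuous functions on compact spaces -/

section SeparateContinuity

open Topology Set

theorem exists_continuousMap_range_of_factors {X A B : Type*} [TopologicalSpace X] [CompactSpace X]
    [TopologicalSpace A] [T2Space A] [TopologicalSpace B] {φ : X → A} (hφ : Continuous φ)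
    {g : X → B} (hg : Continuous g) (h : ∀ x x', φ x = φ x' → g x = g x') :
    ∃ k : C(range φ, B), ∀ x, k ⟨φ x, mem_range_self x⟩ = g x := by
  have hq : IsQuotientMap (rangeFactorization φ) :=
    (hφ.subtype_mk _).isClosedMap.isQuotientMap (hφ.subtype_mk _) rangeFactorization_surjective
  let k : range φ → B := fun z => g z.2.choose
  have hk (x : X) : k ⟨φ x, mem_range_self x⟩ = g x := h _ _ (mem_range_self x).choose_spec
  refine ⟨⟨k, hq.continuous_iff.2 ?_⟩, hk⟩
  convert hg using 1
  exact funext hk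

/-- A family of functions `f (x i)` that are uniformly separated on a countable subset of `Y` is
countable: on the closure of that subset, the functions `f x` factor through a metrizable
quotient. -/
theorem countable_of_separated {X Y S I : Type*} [TopologicalSpace X] [CompactSpace X]
    [TopologicalSpace Y] [CompactSpace Y] [Countable S] {f : X → Y → ℝ}
    (hf₁ : ∀ y, Continuous fun x => f x y) (hf₂ : ∀ x, Continuous (f x)) (y : S → Y) {ε : ℝ}
    (hε : 0 < ε) (x : I → X) (hx : ∀ i j, i ≠ j → ∃ s, ε ≤ |f (x i) (y s) - f (x j) (y s)|) :
    Countable I := by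
  let φ : X → S → ℝ := fun a s => f a (y s)
  have hφ : Continuous φ := continuous_pi fun s => hf₁ (y s)
  -- Every `f · q` with `q` in the closure of the `y s` factors through the metrizable `range φ`.
  have hfac (q : closure (range y)) :
      ∃ k : C(range φ, ℝ), ∀ a, k ⟨φ a, mem_range_self a⟩ = f a q := by
    refine exists_continuousMap_range_of_factors hφ (hf₁ q) fun a a' haa => ?_
    have hcl : IsClosed {z | f a z = f a' z} := isClosed_eq (hf₂ a) (hf₂ a')
    exact closure_minimal (range_subset_iff.2 fun s => congrFun haa s) hcl q.2
  choose k hk using hfac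
  obtain ⟨D, hDc, hD⟩ := TopologicalSpace.exists_countable_dense (range φ)
  have : Countable D := hDc
  let ψ : closure (range y) → D → ℝ := fun q d => k q d
  have hψ : Continuous ψ := by
    refine continuous_pi fun ⟨⟨_, a, rfl⟩, _⟩ => ?_
    exact ((hf₂ a).comp continuous_subtype_val).congr fun q => (hk q a).symm
  have : CompactSpace (closure (range y)) := isCompact_iff_compactSpace.1 isClosed_closure.isCompact
  have hfac' (a : X) : ∃ g : C(range ψ, ℝ), ∀ q, g ⟨ψ q, mem_range_self q⟩ = f a q := by
    refine exists_continuousMap_range_of_factors hψ ((hf₂ a).comp continuous_subtype_val)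
      fun q q' hqq => ?_
    have : k q = k q' := ContinuousMap.coe_injective <|
      (k q).continuous.ext_on hD (k q').continuous fun d hd => congrFun hqq ⟨d, hd⟩
    change f a q = f a q'
    rw [← hk, ← hk, this]
  choose g hg using hfac'
  have : CompactSpace (range ψ) := isCompact_iff_compactSpace.1 (isCompact_range hψ)
  have hsep (i j : I) (hij : i ≠ j) : ε ≤ dist (g (x i)) (g (x j)) := by
    obtain ⟨s, hs⟩ := hx i j hij
    let q : closure (range y) := ⟨y s, subset_closure (mem_range_self s)⟩
    refine hs.trans ?_
    rw [← hg (x i) q, ← hg (x j) q, ← Real.dist_eq]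
    exact ContinuousMap.dist_apply_le_dist _
  refine Pairwise.countable_of_isOpen_disjoint (s := fun i => Metric.ball (g (x i)) (ε / 2))
    (fun i j hij => Metric.ball_disjoint_ball ?_) (fun _ => Metric.isOpen_ball)
    fun i => ⟨_, Metric.mem_ball_self (half_pos hε)⟩
  rw [add_halves]
  exact hsep i j hij

/-- A separately continuous function on a product of compact spaces oscillates little, uniformly in
the second variable, over suitable open subsets of the first factor. -/
theorem exists_isOpen_forall_abs_sub_le {X Y : Type*} [TopologicalSpace X] [CompactSpace X]
    [T2Space X] [TopologicalSpace Y] [CompactSpace Y] {f : X → Y → ℝ}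
    (hf₁ : ∀ y, Continuous fun x => f x y) (hf₂ : ∀ x, Continuous (f x)) {ε : ℝ} (hε : 0 < ε)
    {V : Set X} (hV : IsOpen V) (hVne : V.Nonempty) :
    ∃ W ⊆ V, IsOpen W ∧ W.Nonempty ∧ ∀ x ∈ W, ∀ x' ∈ W, ∀ y, |f x y - f x' y| ≤ ε := by
  by_contra! hcon
  -- Otherwise every open subset of `V` splits into two parts that some `y` separates.
  have step (W : {W : Set X // W ⊆ V ∧ IsOpen W ∧ W.Nonempty}) :
      ∃ (W' : Bool → {W : Set X // W ⊆ V ∧ IsOpen W ∧ W.Nonempty}) (y : Y),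
        (∀ i, closure (W' i).1 ⊆ W.1) ∧
        ∀ x ∈ (W' true).1, ∀ x' ∈ (W' false).1, ε / 2 ≤ |f x y - f x' y| := by
    obtain ⟨W, hWV, hWo, hWne⟩ := W
    obtain ⟨a, ha, b, hb, y, hab⟩ := hcon W hWV hWo hWne
    have hsub (c : X) (hc : c ∈ W) : ∃ T : Set X, c ∈ T ∧ IsOpen T ∧ closure T ⊆ W ∧
        ∀ x ∈ T, |f x y - f c y| < ε / 4 := by
      have hN : W ∩ {x | |f x y - f c y| < ε / 4} ∈ 𝓝 c := by
        refine (hWo.inter (isOpen_lt (by fun_prop) continuous_const)).mem_nhds ⟨hc, ?_⟩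
        simp only [mem_ofPred_eq, sub_self, abs_zero]
        positivity
      obtain ⟨T, hT, hTc, hTs⟩ := exists_mem_nhds_isClosed_subset hN
      refine ⟨interior T, mem_interior_iff_mem_nhds.2 hT, isOpen_interior, ?_, fun x hx => ?_⟩
      · exact (closure_minimal interior_subset hTc).trans (hTs.trans inter_subset_left)
      · exact (hTs (interior_subset hx)).2
    obtain ⟨A, haA, hAo, hAW, hA⟩ := hsub a ha
    obtain ⟨B, hbB, hBo, hBW, hB⟩ := hsub b hb
    refine ⟨fun i => bif i then ⟨A, (subset_closure.trans hAW).trans hWV, hAo, a, haA⟩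
      else ⟨B, (subset_closure.trans hBW).trans hWV, hBo, b, hbB⟩, y, ?_, fun x hx x' hx' => ?_⟩
    · rintro (_ | _)
      · exact hBW
      · exact hAW
    · have h1 := abs_lt.1 (hA x hx)
      have h2 := abs_lt.1 (hB x' hx')
      rcases lt_abs.1 hab with h | h
      · exact le_trans (by linarith) (le_abs_self _)
      · exact le_trans (by linarith) (neg_le_abs _)
  choose next y hcl hsep using step
  let W : List Bool → {W : Set X // W ⊆ V ∧ IsOpen W ∧ W.Nonempty} :=
    fun l => l.rec ⟨V, subset_rfl, hV, hVne⟩ fun i _ U => next U i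
  let pre (σ : ℕ → Bool) : ℕ → List Bool := fun n => n.rec [] fun m l => σ m :: l
  have hpt (σ : ℕ → Bool) : ∃ x, ∀ n, x ∈ (W (pre σ n)).1 := by
    have hne := IsCompact.nonempty_iInter_of_sequence_nonempty_isCompact_isClosed
      (fun n => closure (W (pre σ n)).1)
      (fun n => (hcl (W (pre σ n)) (σ n)).trans subset_closure)
      (fun n => (W (pre σ n)).2.2.2.closure) isClosed_closure.isCompact (fun n => isClosed_closure)
    obtain ⟨x, hx⟩ := hne
    exact ⟨x, fun n => hcl (W (pre σ n)) (σ n) (mem_iInter.1 hx (n + 1))⟩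
  choose x hx using hpt
  have hcount : Countable (ℕ → Bool) := by
    refine countable_of_separated hf₁ hf₂ (fun l => y (W l)) (half_pos hε) x fun σ τ hστ => ?_
    have hex : ∃ n, σ n ≠ τ n := Function.ne_iff.1 hστ
    classical
    have hpre (n : ℕ) (hn : n ≤ Nat.find hex) : pre σ n = pre τ n := by
      induction n with
      | zero => rfl
      | succ m ih =>
        have : σ m = τ m := not_not.1 (Nat.find_min hex hn)
        change σ m :: pre σ m = τ m :: pre τ m
        rw [this, ih (Nat.le_of_succ_le hn)]
    set n := Nat.find hex
    have hne : σ n ≠ τ n := Nat.find_spec hex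
    have h1 : x σ ∈ (next (W (pre σ n)) (σ n)).1 := hx σ (n + 1)
    have h2 : x τ ∈ (next (W (pre τ n)) (τ n)).1 := hx τ (n + 1)
    rw [← hpre n le_rfl] at h2
    refine ⟨pre σ n, ?_⟩
    rcases hσ : σ n with _ | _ <;> rcases hτ : τ n with _ | _ <;> rw [hσ] at h1 hne <;>
      rw [hτ] at h2 hne
    · exact absurd rfl hne
    · rw [abs_sub_comm]
      exact hsep _ _ h2 _ h1
    · exact hsep _ _ h1 _ h2
    · exact absurd rfl hne
  obtain ⟨e, he⟩ := exists_surjective_nat (ℕ → Bool)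
  obtain ⟨n, hn⟩ := he fun n => !(e n n)
  simpa using congrFun hn n

end SeparateContinuity

/-! ### Additive maps between locally compact groups -/

section AdditiveMaps

open Topology Filter

variable {G H : Type*} [AddCommGroup G] [TopologicalSpace G] [IsTopologicalAddGroup G]
  [AddCommGroup H] [TopologicalSpace H] [IsTopologicalAddGroup H]

theorem AddMonoidHom.continuous_of_continuousAt (f : G →+ H) {a : G} (h : ContinuousAt f a) :
    Continuous f := by
  refine continuous_of_continuousAt_zero f ?_
  have h1 : Tendsto (fun x => f (x + a) - f a) (𝓝 0) (𝓝 (f a - f a)) := by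
    refine Tendsto.sub_const (h.tendsto.comp ?_) _
    exact Continuous.tendsto' (by fun_prop) _ _ (zero_add a)
  rw [ContinuousAt, map_zero]
  simpa using h1

/-- A map with additive polarisations (for instance a quadratic map) that is continuous off a finite
set is continuous. -/
theorem continuous_of_polar_additive [Infinite G] {Q : G → H}
    (hQ : ∀ a x y, Q (x + y + a) - Q (x + y) - Q a = (Q (x + a) - Q x - Q a)
      + (Q (y + a) - Q y - Q a)) {S : Set G} (hS : S.Finite) (h : ∀ x ∉ S, ContinuousAt Q x) :
    Continuous Q ∧ ∀ a, Continuous fun x => Q (x + a) - Q x - Q a := by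
  have hL (a : G) : Continuous fun x => Q (x + a) - Q x - Q a := by
    obtain ⟨x, hx⟩ := (hS.union (hS.image (· - a))).exists_notMem
    rw [Set.mem_union, not_or] at hx
    have hxa : x + a ∉ S := fun hxa => hx.2 ⟨x + a, hxa, add_sub_cancel_right x a⟩
    have h1 : ContinuousAt (fun x => Q (x + a)) x :=
      ContinuousAt.comp (g := Q) (h _ hxa) (by fun_prop)
    exact (AddMonoidHom.mk' (fun x => Q (x + a) - Q x - Q a) (hQ a)).continuous_of_continuousAt
      ((h1.sub (h x hx.1)).sub continuousAt_const)
  refine ⟨continuous_iff_continuousAt.2 fun x => ?_, hL⟩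
  obtain ⟨a, ha⟩ := (hS.image (· - x)).exists_notMem
  have hxa : x + a ∉ S := fun hxa => ha ⟨x + a, hxa, add_sub_cancel_left x a⟩
  have h1 : ContinuousAt (fun x => Q (x + a)) x :=
    ContinuousAt.comp (g := Q) (h _ hxa) (by fun_prop)
  have h2 : ContinuousAt (fun z => Q (z + a) - (Q (z + a) - Q z - Q a) - Q a) x :=
    (h1.sub (hL a).continuousAt).sub continuousAt_const
  refine h2.congr (Eventually.of_forall fun z => ?_)
  change Q (z + a) - (Q (z + a) - Q z - Q a) - Q a = Q z
  abel

/-- The limits of `f x` as `x` tends to zero, along arbitrary filters. -/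
def AddMonoidHom.limitsAtZero (f : G →+ H) : Set H :=
  {y | ∃ l : Filter G, l.NeBot ∧ l ≤ 𝓝 0 ∧ Tendsto f l (𝓝 y)}

/-- The closed graph theorem for `σ`-compact locally compact groups. -/
theorem AddMonoidHom.continuous_of_limitsAtZero [LocallyCompactSpace G] [SigmaCompactSpace G]
    [T2Space G] [SigmaCompactSpace H] (f : G →+ H) (h : ∀ y ∈ f.limitsAtZero, y = 0) :
    Continuous f := by
  have hcl : IsClosed (f.graph : Set (G × H)) := by
    refine isClosed_of_closure_subset fun ⟨x₀, y₀⟩ hp => ?_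
    have hgr : (f.graph : Set (G × H)) = Set.range fun x => (x, f x) := by
      ext ⟨x, y⟩
      simp
    rw [hgr, mem_closure_iff_nhds] at hp
    let l : Filter G := comap (fun x => (x, f x)) (𝓝 (x₀, y₀))
    have hl : l.NeBot := comap_neBot_iff.2 fun t ht => by
      obtain ⟨_, hpt, x, rfl⟩ := hp t ht
      exact ⟨x, hpt⟩
    have hl1 : Tendsto (fun x => (x, f x)) l (𝓝 (x₀, y₀)) := tendsto_comap
    rw [nhds_prod_eq, tendsto_prod_iff'] at hl1
    have h0 := h (y₀ - f x₀) ⟨map (· - x₀) l, hl.map _, ?_, ?_⟩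
    · rw [SetLike.mem_coe, AddMonoidHom.mem_graph]
      exact (sub_eq_zero.1 h0).symm
    · have := hl1.1.sub_const x₀
      rwa [sub_self] at this
    · refine tendsto_map'_iff.2 ((hl1.2.sub_const (f x₀)).congr fun x => ?_)
      rw [Function.comp_apply, map_sub]
  have : SigmaCompactSpace f.graph := hcl.isClosedEmbedding_subtypeVal.sigmaCompactSpace
  let p : f.graph →+ G := (AddMonoidHom.fst G H).comp f.graph.subtype
  have hp : Continuous p := continuous_fst.comp continuous_subtype_val
  have hmem (x : G) : (x, f x) ∈ f.graph := rfl
  have hopen : IsOpenMap p :=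
    p.isOpenMap_of_sigmaCompact (fun x => ⟨⟨(x, f x), hmem x⟩, rfl⟩) hp
  have hinv : Continuous fun x => (⟨(x, f x), hmem x⟩ : f.graph) := by
    refine continuous_def.2 fun s hs => ?_
    convert hopen s hs using 1
    ext x
    constructor
    · exact fun hx => ⟨_, hx, rfl⟩
    · rintro ⟨⟨⟨x', y⟩, hxy⟩, hs', rfl⟩
      have : f x' = y := hxy
      subst this
      exact hs'
  exact continuous_snd.comp (continuous_subtype_val.comp hinv)

theorem exists_seq_accumulating_zero [LocallyCompactSpace G] [T2Space G] [NeBot (𝓝[≠] (0 : G))] :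
    ∃ d : ℕ → G, ∀ W ∈ 𝓝 (0 : G), ∃ n, d n ≠ 0 ∧ d n ∈ W := by
  obtain ⟨K, hK, hK0⟩ := exists_compact_mem_nhds (0 : G)
  have hinf : Infinite K := (infinite_of_mem_nhds 0 hK0).to_subtype
  let s := Infinite.natEmbedding K
  obtain ⟨p, -, hp⟩ := hK.exists_mapClusterPt (f := atTop) (u := fun n => (s n : G))
    (tendsto_principal.2 (Eventually.of_forall fun n => (s n).2))
  refine ⟨fun n => s n - p, fun W hW => ?_⟩
  have hW' : {x | x - p ∈ W} ∈ 𝓝 p :=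
    (continuous_sub_right p).tendsto' p 0 (sub_self p) hW
  have hfreq := hp.frequently hW'
  have hev : ∀ᶠ n in atTop, (s n : G) - p ≠ 0 := by
    by_cases hm : ∃ m, (s m : G) = p
    · obtain ⟨m, rfl⟩ := hm
      filter_upwards [eventually_gt_atTop m] with n hn h0
      exact hn.ne' (s.injective (Subtype.ext (sub_eq_zero.1 h0)))
    · exact Eventually.of_forall fun n h0 => hm ⟨n, sub_eq_zero.1 h0⟩
  obtain ⟨n, hn, hn'⟩ := (hfreq.and_eventually hev).exists
  exact ⟨n, hn', hn⟩

/-- A separately continuous biadditive map on a first countable locally compact group is continuous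
at the origin, by Baire's theorem. -/
theorem tendsto_uncurry_zero_of_separately_continuous [LocallyCompactSpace G] [T2Space G]
    [(𝓝 (0 : G)).IsCountablyGenerated] (m : G →+ G →+ H) (h₁ : ∀ y, Continuous fun x => m x y)
    (h₂ : ∀ x, Continuous (m x)) :
    Tendsto (Function.uncurry fun x y => m x y) (𝓝 0 ×ˢ 𝓝 0) (𝓝 0) := by
  obtain ⟨V, hV⟩ := (𝓝 (0 : G)).exists_antitone_basis
  intro W hW
  have hsub : Tendsto (fun p : H × H => p.1 - p.2) (𝓝 (0, 0)) (𝓝 0) :=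
    Continuous.tendsto' (by fun_prop) _ _ (sub_zero 0)
  obtain ⟨W₁, hW₁, hW₁W⟩ : ∃ W₁ ∈ 𝓝 (0 : H), ∀ x ∈ W₁, ∀ y ∈ W₁, x - y ∈ W := by
    have := hsub hW
    rw [mem_map, nhds_prod_eq, mem_prod_same_iff] at this
    obtain ⟨W₁, hW₁, hs⟩ := this
    exact ⟨W₁, hW₁, fun x hx y hy => hs (Set.mk_mem_prod hx hy)⟩
  obtain ⟨W₀, hW₀, hW₀c, hW₀W⟩ := exists_mem_nhds_isClosed_subset hW₁
  let A : ℕ → Set G := fun n => ⋂ v ∈ V n, {x | m x v ∈ W₀}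
  have hA (n : ℕ) : IsClosed (A n) :=
    isClosed_biInter fun v _ => hW₀c.preimage (h₁ v)
  have hAU : ⋃ n, A n = Set.univ := by
    refine Set.eq_univ_of_forall fun x => ?_
    have := (h₂ x).tendsto' 0 0 (map_zero _) hW₀
    obtain ⟨n, -, hn⟩ := hV.1.mem_iff.1 this
    exact Set.mem_iUnion.2 ⟨n, Set.mem_iInter₂.2 fun v hv => hn hv⟩
  obtain ⟨n, x₀, hx₀⟩ := nonempty_interior_of_iUnion_of_closed hA hAU
  have hU : {u | x₀ + u ∈ interior (A n)} ∈ 𝓝 (0 : G) :=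
    (continuous_const_add x₀).tendsto' 0 x₀ (add_zero x₀) (isOpen_interior.mem_nhds hx₀)
  refine mem_map.2 (mem_of_superset (prod_mem_prod hU (hV.1.mem_of_mem (i := n) trivial)) ?_)
  rintro ⟨u, v⟩ ⟨hu, hv⟩
  have e1 := hW₀W (Set.mem_iInter₂.1 (interior_subset hu) v hv)
  have e2 := hW₀W (Set.mem_iInter₂.1 (interior_subset hx₀) v hv)
  have e3 := hW₁W _ e1 _ e2
  simpa [map_add] using e3

end AdditiveMaps

/-! ### Continuity of the Jordan operations -/

namespace AlternativeDivisionRing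

open Topology Filter

variable {F : Type u} [AlternativeDivisionRing F] [TopologicalSpace F] [IsTopologicalAddGroup F]
  [ContinuousInv₀ F] [T2Space F]

/-- Hua's identity expresses `x y x` through additions and inversions only. -/
theorem continuousAt_mul_mul {x y : F} (hx : x ≠ 0) (hy : y ≠ 0) (hxy : x ≠ y⁻¹) :
    ContinuousAt (fun p : F × F => p.1 * (p.2 * p.1)) (x, y) := by
  have inv_comp {f : F × F → F} (hf : ContinuousAt f (x, y)) (h0 : f (x, y) ≠ 0) :
      ContinuousAt (fun p => (f p)⁻¹) (x, y) :=
    ContinuousAt.comp (g := Inv.inv) (ContinuousInv₀.continuousAt_inv₀ h0) hf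
  have h1 : ContinuousAt (fun p : F × F => p.1⁻¹) (x, y) := inv_comp continuousAt_fst hx
  have h2 : ContinuousAt (fun p : F × F => p.2⁻¹) (x, y) := inv_comp continuousAt_snd hy
  have h3 : ContinuousAt (fun p : F × F => p.2⁻¹ - p.1) (x, y) := h2.sub continuousAt_fst
  have h4 := h1.add (inv_comp h3 (sub_ne_zero.2 hxy.symm))
  have h5 : x⁻¹ + (y⁻¹ - x)⁻¹ ≠ 0 := fun h => by
    have := inv_add_inv_mul hx hy hxy
    rw [h, zero_mul] at this
    exact zero_ne_one this
  refine (continuousAt_fst.sub (inv_comp h4 h5)).congr ?_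
  filter_upwards [continuousAt_fst.eventually_ne hx, continuousAt_snd.eventually_ne hy,
    h3.eventually_ne (sub_ne_zero.2 hxy.symm)] with p hp1 hp2 hp3
  exact (hua hp1 hp2 (sub_ne_zero.1 hp3).symm).symm

theorem continuous_mul_mul_left [Infinite F] (x : F) : Continuous fun y => x * (y * x) := by
  by_cases hx : x = 0
  · simpa [hx] using continuous_const
  obtain ⟨y, hy⟩ := (Set.toFinite {0, x⁻¹}).exists_notMem
  simp only [Set.mem_insert_iff, Set.mem_singleton_iff, not_or] at hy
  have hxy : x ≠ y⁻¹ := fun h => hy.2 (by rw [h, inv_inv'])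
  exact ((AddMonoidHom.mulLeft x).comp (AddMonoidHom.mulRight x)).continuous_of_continuousAt
    (ContinuousAt.comp (g := fun p : F × F => p.1 * (p.2 * p.1)) (f := fun y => (x, y))
      (continuousAt_mul_mul hx hy.1 hxy) (by fun_prop))

theorem continuous_quadratic [Infinite F] (y : F) :
    (Continuous fun x => x * (y * x)) ∧
      ∀ a, Continuous fun x => (x + a) * (y * (x + a)) - x * (y * x) - a * (y * a) := by
  refine continuous_of_polar_additive (Q := fun x => x * (y * x)) (fun a x z => ?_)
    (Set.toFinite {0, y⁻¹}) fun x hx => ?_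
  · simp only [add_mul, mul_add]
    abel
  · simp only [Set.mem_insert_iff, Set.mem_singleton_iff, not_or] at hx
    by_cases hy : y = 0
    · simpa [hy] using continuousAt_const
    · exact ContinuousAt.comp (g := fun p : F × F => p.1 * (p.2 * p.1)) (f := fun x => (x, y))
        (continuousAt_mul_mul hx.1 hy hx.2) (by fun_prop)

theorem continuous_jordan_mul [Infinite F] (a : F) : Continuous fun x => a * x + x * a := by
  refine ((continuous_quadratic (1 : F)).2 a).congr fun x => ?_
  simp only [one_mul, add_mul, mul_add]
  abel

theorem continuous_jordan_triple [Infinite F] (a b : F) :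
    Continuous fun x => a * (x * b) + b * (x * a) := by
  have h : Continuous fun x => (a + b) * (x * (a + b)) - a * (x * a) - b * (x * b) :=
    ((continuous_mul_mul_left _).sub (continuous_mul_mul_left _)).sub (continuous_mul_mul_left _)
  refine h.congr fun x => ?_
  simp only [add_mul, mul_add]
  abel

theorem continuous_mul_mul_sub [Infinite F] (e b : F) :
    Continuous fun x => e * (b * x) - (b * e) * x := by
  simp only [mul_mul_sub_eq_jordan]
  exact ((continuous_jordan_mul (e * b)).add (continuous_jordan_triple b e)).sub
    ((continuous_jordan_mul b).comp (continuous_jordan_mul e))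

/-- A nondiscrete locally compact alternative division ring is covered by the compact sets
`d⁻¹ K d⁻¹` where `K` is a compact neighbourhood of zero and `d` runs through a sequence that
accumulates at zero. -/
theorem sigmaCompactSpace [LocallyCompactSpace F] [Infinite F] [NeBot (𝓝[≠] (0 : F))] :
    SigmaCompactSpace F := by
  obtain ⟨d, hd⟩ := exists_seq_accumulating_zero (G := F)
  obtain ⟨K, hK, hK0⟩ := exists_compact_mem_nhds (0 : F)
  rw [← isSigmaCompact_univ_iff]
  have hcov : (⋃ n, (fun y => (d n)⁻¹ * (y * (d n)⁻¹)) '' K) = Set.univ := by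
    refine Set.eq_univ_of_forall fun x => Set.mem_iUnion.2 ?_
    obtain ⟨n, hn, hnK⟩ := hd _ ((continuous_quadratic x).1.tendsto' 0 0 (zero_mul _) hK0)
    exact ⟨n, _, hnK, inv_quad_quad hn x⟩
  rw [← hcov]
  exact isSigmaCompact_iUnion_of_isCompact _ fun n => hK.image (continuous_mul_mul_left _)

/-! ### Continuity of the multiplications -/

theorem jordan_mem_limitsAtZero [Infinite F] {e y : F}
    (hy : y ∈ (AddMonoidHom.mulLeft e).limitsAtZero) (b : F) :
    b * y + y * b ∈ (AddMonoidHom.mulLeft e).limitsAtZero := by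
  obtain ⟨l, hl, hl0, hly⟩ := hy
  have hV := continuous_jordan_mul b
  refine ⟨map (fun x => b * x + x * b) l, hl.map _, ?_, tendsto_map'_iff.2 ?_⟩
  · exact (hV.tendsto' 0 0 (by simp)).mono_left hl0
  · have h1 : Tendsto (fun x => e * (b * x) - (b * e) * x) l (𝓝 0) :=
      ((continuous_mul_mul_sub e b).tendsto' 0 0 (by simp)).mono_left hl0
    have h2 := h1.add ((hV.tendsto y).comp hly)
    rw [zero_add] at h2
    refine h2.congr fun x => ?_
    rw [mul_mul_sub_eq_commutator]
    simp

theorem mul_mul_eq_of_mem_limitsAtZero [Infinite F] {e y : F}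
    (hy : y ∈ (AddMonoidHom.mulLeft e).limitsAtZero) (b : F) : e * (b * y) = (b * e) * y := by
  obtain ⟨l, hl, hl0, hly⟩ := hy
  have h1 : Tendsto (fun x => e * (b * (e * x)) - (b * e) * (e * x)) l (𝓝 0) := by
    simp only [mul_mul_sub_mul]
    exact ((continuous_mul_mul_sub e (b * e)).tendsto' 0 0 (by simp)).mono_left hl0
  exact sub_eq_zero.1 (tendsto_nhds_unique
    (((continuous_mul_mul_sub e b).tendsto y).comp hly) h1)

/-- Commutativity gives `(e x)² = e x² e`, and the right hand side is continuous in `x`. -/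
theorem continuous_mul_left_of_commutative [LocallyCompactSpace F] [Infinite F]
    [SigmaCompactSpace F] (hc : ∀ a b : F, a * b = b * a) (e : F) :
    Continuous fun x => e * x := by
  refine (AddMonoidHom.mulLeft e).continuous_of_limitsAtZero fun y ⟨l, hl, hl0, hly⟩ => ?_
  have hsq : Continuous fun x : F => x * x := by simpa using (continuous_quadratic (1 : F)).1
  have h1 : Tendsto (fun x => e * ((x * x) * e)) l (𝓝 0) :=
    (((continuous_mul_mul_left e).comp hsq).tendsto' 0 0 (by simp)).mono_left hl0
  have h2 : Tendsto (fun x => (e * x) * (e * x)) l (𝓝 (y * y)) := (hsq.tendsto y).comp hly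
  have h3 (x : F) : (e * x) * (e * x) = e * ((x * x) * e) := by
    have h4 : associator e x (e * x) = 0 := by
      rw [associator_swap_right, ← associator_mul_self, associator_right, zero_mul, neg_zero]
    rw [associator_apply, sub_eq_zero] at h4
    rw [h4, hc e x, left_alternative]
  have h5 : y * y = 0 := tendsto_nhds_unique h2 (h1.congr fun x => (h3 x).symm)
  exact (eq_zero_of_mul_eq_zero h5).elim id id

/-- The elements whose left multiplication is continuous. -/
def continuousMulLeft (F : Type u) [AlternativeDivisionRing F] [TopologicalSpace F]
    [IsTopologicalAddGroup F] : AddSubgroup F where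
  carrier := {e | Continuous fun x => e * x}
  zero_mem' := by simpa using continuous_const
  add_mem' {a b} ha hb := (Continuous.add ha hb).congr fun x => (add_mul a b x).symm
  neg_mem' {a} ha := (Continuous.neg ha).congr fun x => (neg_mul a x).symm

/-- In the noncommutative case, the obstruction to the continuity of the left multiplication by `e`,
the set `limitsAtZero`, satisfies the hypotheses of `commute_of_jordan_stable`. -/
theorem continuous_mul_left [LocallyCompactSpace F] [Infinite F] [SigmaCompactSpace F] (e : F) :
    Continuous fun x => e * x := by
  by_cases hc : ∀ a b : F, a * b = b * a
  · exact continuous_mul_left_of_commutative hc e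
  push Not at hc
  have key (e : F) (he : e ∉ continuousMulLeft F) :
      ((1 : F) + 1 ≠ 0 → ∀ b, e * b = b * e) ∧
        ((1 : F) + 1 = 0 → ∀ b, (e * e) * b = b * (e * e)) := by
    have hex : ∃ y ∈ (AddMonoidHom.mulLeft e).limitsAtZero, y ≠ 0 := by
      by_contra! h
      exact he ((AddMonoidHom.mulLeft e).continuous_of_limitsAtZero h)
    obtain ⟨y, hy, hy0⟩ := hex
    exact commute_of_jordan_stable (fun y hy => jordan_mem_limitsAtZero hy)
      (fun y hy => mul_mul_eq_of_mem_limitsAtZero hy) hy hy0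
  exact mem_of_contains_noncentral hc (fun e he => (key e he).1) (fun e he => (key e he).2) e

theorem continuous_mul_right [LocallyCompactSpace F] [Infinite F] [SigmaCompactSpace F] (e : F) :
    Continuous fun x => x * e :=
  ((continuous_jordan_mul e).sub (continuous_mul_left e)).congr fun _ => add_sub_cancel_left _ _

theorem isTopologicalRing [LocallyCompactSpace F] [Infinite F] [SigmaCompactSpace F]
    [(𝓝 (0 : F)).IsCountablyGenerated] : IsTopologicalRing F := by
  have h := tendsto_uncurry_zero_of_separately_continuous (AddMonoidHom.mul (R := F))
    continuous_mul_right continuous_mul_left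
  exact IsTopologicalRing.of_addGroup_of_nhds_zero h
    (fun x => (continuous_mul_left x).tendsto' 0 0 (mul_zero x))
    fun x => (continuous_mul_right x).tendsto' 0 0 (zero_mul x)

end AlternativeDivisionRing

/-! ### The topology induced by a compact projective line -/

namespace ProjectiveLine

theorem point_injective {F : Type u} : Function.Injective (point : F → ProjectiveLine F) :=
  fun _ _ h => point.inj h

theorem range_point {F : Type u} : Set.range (point : F → ProjectiveLine F) = {infty}ᶜ := by
  ext p
  cases p <;> simp

variable {F : Type u} [AlternativeDivisionRing F]

theorem translate_zero (p : ProjectiveLine F) : translate 0 p = p := by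
  cases p <;> simp [translate]

theorem translate_add (a b : F) (p : ProjectiveLine F) :
    translate (a + b) p = translate a (translate b p) := by
  cases p <;> simp [translate, add_assoc]

end ProjectiveLine

namespace IsCompactProjectiveLine

open Topology Filter
open ProjectiveLine hiding translate

variable {F : Type u} [AlternativeDivisionRing F] [TopologicalSpace (ProjectiveLine F)]

theorem continuous_translate (h : IsCompactProjectiveLine F) (a : F) :
    Continuous (ProjectiveLine.translate a) :=
  (h.isHomeomorph _ (Subgroup.subset_closure (Or.inl ⟨a, rfl⟩))).continuous

theorem continuous_negInv (h : IsCompactProjectiveLine F) :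
    Continuous (negInv : ProjectiveLine F → ProjectiveLine F) :=
  (h.isHomeomorph _ (Subgroup.subset_closure (Or.inr rfl))).continuous

/-- Close to the identity, the translations move no point by much: the action of `F` on `P` by
translations is separately continuous, because `a + x` is symmetric in `a` and `x`. -/
theorem exists_isOpen_abs_translate_sub_le (h : IsCompactProjectiveLine F)
    (f : C(ProjectiveLine F, ℝ)) {ε : ℝ} (hε : 0 < ε) :
    ∃ W : Set (ProjectiveLine F), IsOpen W ∧ point 0 ∈ W ∧
      ∀ u, point u ∈ W → ∀ p, |f (ProjectiveLine.translate u p) - f p| ≤ ε := by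
  have := h.compactSpace
  have := h.t2Space
  let s : ProjectiveLine F → ProjectiveLine F → ProjectiveLine F
    | point a, p => ProjectiveLine.translate a p
    | infty, _ => infty
  have hs (p : ProjectiveLine F) : Continuous fun a => s a p := by
    cases p with
    | infty =>
      have : (fun a : ProjectiveLine F => s a infty) = fun _ => infty := by
        funext a
        cases a <;> rfl
      rw [this]
      exact continuous_const
    | point x =>
      have : (fun a : ProjectiveLine F => s a (point x)) = ProjectiveLine.translate x := by
        funext a
        cases a with
        | infty => rfl
        | point a => exact congrArg point (add_comm a x)
      rw [this]
      exact h.continuous_translate x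
  have hs' (a : ProjectiveLine F) : Continuous (s a) := by
    cases a with
    | infty => exact continuous_const
    | point a => exact h.continuous_translate a
  -- `{∞}ᶜ` is used so that the open set found contains a point of `F` to translate back to zero.
  obtain ⟨W, hWV, hWo, ⟨a, ha⟩, hW⟩ := exists_isOpen_forall_abs_sub_le
    (f := fun a p => f (s a p)) (fun p => f.continuous.comp (hs p))
    (fun a => f.continuous.comp (hs' a)) hε (V := {infty}ᶜ) isClosed_singleton.isOpen_compl
    ⟨point 0, by simp⟩
  cases a with
  | infty => exact absurd rfl (hWV ha)
  | point a =>
    refine ⟨ProjectiveLine.translate a ⁻¹' W, hWo.preimage (h.continuous_translate a), ?_,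
      fun u hu p => ?_⟩
    · change point (a + 0) ∈ W
      rwa [add_zero]
    · have h1 := hW _ hu _ ha (ProjectiveLine.translate (-a) p)
      change |f (ProjectiveLine.translate (a + u) (ProjectiveLine.translate (-a) p)) -
        f (ProjectiveLine.translate a (ProjectiveLine.translate (-a) p))| ≤ ε at h1
      rwa [← ProjectiveLine.translate_add, ← ProjectiveLine.translate_add, add_neg_cancel,
        ProjectiveLine.translate_zero, add_neg_cancel_comm] at h1

variable [TopologicalSpace F]

/-- The translations act jointly continuously on the projective line. -/
theorem tendsto_translate (h : IsCompactProjectiveLine F)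
    (hi : IsInducing (point : F → ProjectiveLine F)) (p : ProjectiveLine F) :
    Tendsto (fun q : F × ProjectiveLine F => ProjectiveLine.translate q.1 q.2)
      (𝓝 0 ×ˢ 𝓝 p) (𝓝 p) := by
  have := h.compactSpace
  have := h.t2Space
  intro O hO
  obtain ⟨f, hf0, hf1, -⟩ := exists_continuous_zero_one_of_isClosed
    (isClosed_compl_iff.2 isOpen_interior : IsClosed (interior O)ᶜ) (isClosed_singleton (x := p))
    (Set.disjoint_singleton_right.2 fun hp => hp (mem_interior_iff_mem_nhds.2 hO))
  obtain ⟨W, hWo, hW0, hW⟩ := h.exists_isOpen_abs_translate_sub_le f (ε := 1 / 2) (by norm_num)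
  have h1 : point ⁻¹' W ∈ 𝓝 (0 : F) := hi.continuous.continuousAt (hWo.mem_nhds hW0)
  have h2 : {q | 1 / 2 < f q} ∈ 𝓝 p := by
    refine (isOpen_lt continuous_const f.continuous).mem_nhds ?_
    have : f p = 1 := hf1 rfl
    rw [Set.mem_ofPred_eq, this]
    norm_num
  refine mem_map.2 (mem_of_superset (prod_mem_prod h1 h2) ?_)
  rintro ⟨u, q⟩ ⟨hu, hq⟩
  change ProjectiveLine.translate u q ∈ O
  by_contra hO'
  have h3 : f (ProjectiveLine.translate u q) = 0 := hf0 fun hin => hO' (interior_subset hin)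
  have h4 := (abs_le.1 (hW u hu q)).1
  rw [h3] at h4
  have h5 : 1 / 2 < f q := hq
  linarith

theorem isOpenEmbedding_point (h : IsCompactProjectiveLine F)
    (hi : IsInducing (point : F → ProjectiveLine F)) :
    IsOpenEmbedding (point : F → ProjectiveLine F) := by
  have := h.t2Space
  refine ⟨⟨hi, point_injective⟩, ?_⟩
  rw [range_point]
  exact isClosed_singleton.isOpen_compl

theorem continuous_const_add (h : IsCompactProjectiveLine F)
    (hi : IsInducing (point : F → ProjectiveLine F)) (a : F) : Continuous fun x : F => a + x :=
  hi.continuous_iff.2 ((h.continuous_translate a).comp hi.continuous)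

/-- Joint continuity of the translations on all of `P`, and not only on `F`, is what yields the
continuity of the negation. -/
theorem isTopologicalAddGroup (h : IsCompactProjectiveLine F)
    (hi : IsInducing (point : F → ProjectiveLine F)) : IsTopologicalAddGroup F := by
  have := h.compactSpace
  have := h.t2Space
  have hadd : Tendsto (Function.uncurry ((· + ·) : F → F → F)) (𝓝 0 ×ˢ 𝓝 0) (𝓝 0) :=
    hi.tendsto_nhds_iff.2 ((h.tendsto_translate hi (point 0)).comp
      (tendsto_id.prodMap hi.continuous.continuousAt))
  refine IsTopologicalAddGroup.of_comm_of_nhds_zero hadd ?_ fun a => ?_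
  · rw [hi.tendsto_nhds_iff, tendsto_iff_ultrafilter]
    intro l hl
    -- Along an ultrafilter `u → 0`, the points `-u` converge in `P`, and `u + (-u) = 0` forces the
    -- limit to be zero.
    let m := l.map fun u => point (-u)
    obtain ⟨p, -, hp⟩ := isCompact_univ.ultrafilter_le_nhds m (by simp)
    have hp' : Tendsto (fun u => point (-u)) (l : Filter F) (𝓝 p) := hp
    have h1 := (h.tendsto_translate hi p).comp (Tendsto.prodMk hl hp')
    have h2 : Tendsto (fun _ : F => point (0 : F)) (l : Filter F) (𝓝 p) :=
      h1.congr fun u => congrArg point (add_neg_cancel u)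
    have h3 : p = point 0 := tendsto_nhds_unique h2 tendsto_const_nhds
    rw [h3] at hp'
    exact hp'
  · let e : F ≃ₜ F :=
      { Equiv.addLeft a with
        continuous_toFun := h.continuous_const_add hi a
        continuous_invFun := h.continuous_const_add hi (-a) }
    have := e.map_nhds_eq 0
    change map (fun x => a + x) (𝓝 0) = 𝓝 (a + 0) at this
    rw [this, add_zero]

theorem continuousInv₀ (h : IsCompactProjectiveLine F)
    (hi : IsInducing (point : F → ProjectiveLine F)) : ContinuousInv₀ F where
  continuousAt_inv₀ x hx := by
    have := h.isTopologicalAddGroup hi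
    have := h.t2Space
    have hT2 : T2Space F := (h.isOpenEmbedding_point hi).isEmbedding.t2Space
    have h1 : ContinuousAt (fun y : F => -y⁻¹) x := by
      rw [hi.continuousAt_iff]
      refine (h.continuous_negInv.comp hi.continuous).continuousAt.congr ?_
      filter_upwards [isOpen_ne.mem_nhds hx] with y hy
      exact if_neg hy
    exact h1.neg.congr (Eventually.of_forall fun y => neg_neg y⁻¹)

theorem not_discreteTopology (h : IsCompactProjectiveLine F)
    (hi : IsInducing (point : F → ProjectiveLine F)) : ¬ DiscreteTopology F := by
  intro hd
  have := h.compactSpace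
  have h0 : IsOpen {(point 0 : ProjectiveLine F)} := by
    rw [← Set.image_singleton]
    exact (h.isOpenEmbedding_point hi).isOpenMap _ (isOpen_discrete _)
  have : DiscreteTopology (ProjectiveLine F) := by
    refine discreteTopology_iff_isOpen_singleton.2 fun p => ?_
    cases p with
    | infty =>
      convert h0.preimage h.continuous_negInv using 1
      ext p
      rw [Set.mem_singleton_iff, Set.mem_preimage, Set.mem_singleton_iff]
      constructor
      · rintro rfl
        rfl
      · intro hp
        rw [← negInv_negInv p, hp]
        exact if_pos rfl
    | point x =>
      convert h0.preimage (h.continuous_translate (-x)) using 1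
      ext p
      cases p with
      | infty => simp [ProjectiveLine.translate]
      | point y => simp [ProjectiveLine.translate, neg_add_eq_zero, eq_comm]
  have : Finite (ProjectiveLine F) := finite_of_compact_of_discrete
  exact not_finite_iff_infinite.2 h.infinite (Finite.of_injective _ (point_injective (F := F)))

/-- If `F` is `σ`-compact, then `∞`, and hence `0`, has a countable neighbourhood basis. -/
theorem isCountablyGenerated_nhds_zero (h : IsCompactProjectiveLine F)
    (hi : IsInducing (point : F → ProjectiveLine F)) [SigmaCompactSpace F]
    [LocallyCompactSpace F] : (𝓝 (0 : F)).IsCountablyGenerated := by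
  have := h.compactSpace
  have := h.t2Space
  let K := CompactExhaustion.choice F
  have hb : (𝓝 (infty : ProjectiveLine F)).HasBasis (fun _ : ℕ => True)
      fun n => (point '' K n)ᶜ := by
    refine ⟨fun O => ⟨fun hO => ?_, fun ⟨n, _, hn⟩ => mem_of_superset ?_ hn⟩⟩
    · have hc : IsCompact (point ⁻¹' (interior O)ᶜ : Set F) := by
        refine hi.isCompact_preimage' isOpen_interior.isClosed_compl.isCompact ?_
        rw [range_point, Set.compl_subset_compl, Set.singleton_subset_iff]
        exact mem_interior_iff_mem_nhds.2 hO
      obtain ⟨n, hn⟩ := K.exists_superset_of_isCompact hc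
      refine ⟨n, trivial, fun p hp => ?_⟩
      cases p with
      | infty => exact mem_of_mem_nhds hO
      | point x =>
        by_contra hx
        exact hp ⟨x, hn fun hx' => hx (interior_subset hx'), rfl⟩
    · exact ((K.isCompact n).image hi.continuous).isClosed.isOpen_compl.mem_nhds (by simp)
  have hg : (𝓝 (infty : ProjectiveLine F)).IsCountablyGenerated :=
    HasCountableBasis.isCountablyGenerated ⟨hb, Set.to_countable _⟩
  let e : ProjectiveLine F ≃ₜ ProjectiveLine F :=
    { inversion with
      continuous_toFun := h.continuous_negInv
      continuous_invFun := h.continuous_negInv }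
  have he : e (point 0) = infty := if_pos rfl
  rw [hi.nhds_eq_comap, ← e.symm_apply_apply (point 0), he, ← e.comap_nhds_eq]
  infer_instance

end IsCompactProjectiveLine

/-- Let `F` be a field, a skew field or an alternative division ring whose projective line is a
compact projective line.  With the subspace topology coming from `F ⊆ F ∪ {∞}`, `F` is a
(Hausdorff) locally compact, non-discrete, σ-compact topological alternative division ring. -/
theorem mainTheorem4 (F : Type u) [AlternativeDivisionRing F]
    [TopologicalSpace (ProjectiveLine F)] (h : IsCompactProjectiveLine F) :
    letI : TopologicalSpace F := TopologicalSpace.induced ProjectiveLine.point inferInstance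
    T2Space F ∧ LocallyCompactSpace F ∧ ¬ DiscreteTopology F ∧ SigmaCompactSpace F ∧
      IsTopologicalAlternativeDivisionRing F := by
  let _ : TopologicalSpace F := TopologicalSpace.induced ProjectiveLine.point inferInstance
  have hi : Topology.IsInducing (ProjectiveLine.point : F → ProjectiveLine F) := ⟨rfl⟩
  have := h.compactSpace
  have := h.t2Space
  have := h.infinite
  have he := h.isOpenEmbedding_point hi
  have h1 : T2Space F := he.isEmbedding.t2Space
  have h2 : LocallyCompactSpace F := he.locallyCompactSpace
  have h3 := h.not_discreteTopology hi
  have := h.isTopologicalAddGroup hi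
  have h4 : ContinuousInv₀ F := h.continuousInv₀ hi
  have : Filter.NeBot (nhdsWithin (0 : F) {0}ᶜ) := by
    rw [Filter.neBot_iff, Ne, ← isOpen_singleton_iff_punctured_nhds]
    exact fun h0 => h3 (discreteTopology_of_isOpen_singleton_zero h0)
  have h5 : SigmaCompactSpace F := AlternativeDivisionRing.sigmaCompactSpace
  have := h.isCountablyGenerated_nhds_zero hi
  have h6 : IsTopologicalRing F := AlternativeDivisionRing.isTopologicalRing
  exact ⟨h1, h2, h3, h5, { toIsTopologicalRing := h6, toContinuousInv₀ := h4 }⟩
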